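/- Let $N$ be a finite set of players, $2\le \#N<\infty$. For $1\le K\le \#N$ let $\mathcal P(K)$ be the set of all partitions (coalition structures) $P$ of $N$ into nonempty pairwise disjoint coalitions of size at most $K$. A game $\Gamma(K)$ of coalition structure formation consists of: - for each player $i\in N$ and each $P\in\mathcal P(K)$ a finite set $S_i(P)$ of strategies, such that $S_i(K)=\bigcup_{P\in\mathcal P(K)}S_i(P)$ is nonempty; put $S(K)=\prod_{i\in N}S_i(K)$; - a mechanism $\mathcal R(K)$ that assigns to every strategy profile $s\in S(K)$ exactly one coalition structure in $\mathcal P(K)$, so that $S(K)=\bigsqcup_{P\in\mathcal P(K)}S(P)$, where $S(P)$ is the set of profiles to which $P$ is assigned; - for each $i\in N$ and $P\in\mathcal P(K)$ a payoff function $U_i(P)\colon S(P)\to\mathbb R$. A mixed strategy $\sigma_i\in\Delta_i(K)$ is a probability distribution on $S_i(K)$. The expected utility of player $i$ under a profile $\sigma=(\sigma_j)_{j\in N}$ of mixed strategies is $$EU_i^{\Gamma(K)}(\sigma)=\sum_{P\in\mathcal P(K)}\ \sum_{s\in S(P)}\Big(\prod_{j\in N}\sigma_j(s_j)\Big)\,U_i(P)(s).$$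 The profile $\sigma^*(K)=(\sigma_i^*(K))_{i\in N}$ is an equilibrium of $\Gamma(K)$ if for every subset $n\subseteq N$ with $1\le \#n\le K$, every $i\in n$ and every $\sigma_i\in\Delta_i(K)$ with $\sigma_i\ne\sigma_i^*(K)$, $$EU_i^{\Gamma(K)}\big(\sigma_i^*(K),\sigma_{-i}^*(K)\big)\ \ge\ EU_i^{\Gamma(K)}\big(\sigma_i,\sigma_{-i}^*(K)\big).$$ A family $\mathcal G=\{\Gamma(K)\colon K=1,\dots,\#N\}$ is nested, $\Gamma(1)\subset\dots\subset\Gamma(\#N)$, if for $K\le L$ the strategy sets $S_i(P)$ of $\Gamma(K)$ and $\Gamma(L)$ coincide for all $P\in\mathcal P(K)$, and the mechanism and the payoffs of $\Gamma(L)$ agree with those of $\Gamma(K)$ on all strategy profiles in $S(K)$. **Theorem.** For every nested family $\mathcal G=\{\Gamma(K)\colon K=1,\dots,\#N\}$ of games of coalition structure formation there are mixed strategy profiles $$\sigma^*(\mathcal G)=\big(\sigma^*(1),\dots,\sigma^*(K),\dots,\sigma^*(\#N)\big)$$ such that, for every $K=1,\dots,\#N$, $\sigma^*(K)=(\sigma_i^*(K))_{i\in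 N}$ is an equilibrium of $\Gamma(K)$. -/

import Mathlib

/-- `𝒫(K)`: the coalition structures (partitions of the finite player set `ι` into nonempty,
pairwise disjoint coalitions) in which every coalition has at most `K` members. -/
abbrev CoalitionStructure (ι : Type*) [Fintype ι] [DecidableEq ι] (K : ℕ) : Type _ :=
  {P : Finpartition (Finset.univ : Finset ι) // ∀ g ∈ P.parts, g.card ≤ K}

/-- The inclusion `𝒫(K) ⊆ 𝒫(L)` for `K ≤ L`. -/
def CoalitionStructure.incl {ι : Type*} [Fintype ι] [DecidableEq ι] {K L : ℕ} (h : K ≤ L)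
    (P : CoalitionStructure ι K) : CoalitionStructure ι L :=
  ⟨P.1, fun g hg => (P.2 g hg).trans h⟩

/-- The strategy set `S_i(K) = ⋃_{P ∈ 𝒫(K)} S_i(P)` of player `i`, where `strat i P = S_i(P)`. -/
def strategySet {ι : Type*} [Fintype ι] [DecidableEq ι] {A : ι → Type*} {K : ℕ}
    (strat : ∀ i, CoalitionStructure ι K → Finset (A i)) (i : ι) : Set (A i) :=
  {a | ∃ P, a ∈ strat i P}

noncomputable instance {ι : Type*} [Fintype ι] [DecidableEq ι] {A : ι → Type*} {K : ℕ}
    (strat : ∀ i, CoalitionStructure ι K → Finset (A i)) (i : ι) :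
    Fintype ↥(strategySet strat i) :=
  Set.Finite.fintype (by
    have h : strategySet strat i = ⋃ P, (strat i P : Set (A i)) := by
      ext a; simp [strategySet]
    rw [h]
    exact Set.finite_iUnion fun P => (strat i P).finite_toSet)

/-- The set of pure strategy profiles `S(K) = ∏_i S_i(K)`. -/
abbrev StrategyProfile {ι : Type*} [Fintype ι] [DecidableEq ι] {A : ι → Type*} {K : ℕ}
    (strat : ∀ i, CoalitionStructure ι K → Finset (A i)) : Type _ :=
  ∀ i, ↥(strategySet strat i)

/-- The game `Γ(K)` of coalition structure formation with maximum coalition size `K`, with player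
set `ι`; the strategies of player `i` are elements of an ambient type `A i`. -/
structure CoalitionGame (ι : Type*) [Fintype ι] [DecidableEq ι] (A : ι → Type*) (K : ℕ) where
  /-- The finite strategy set `S_i(P)` of player `i` for the coalition structure `P`. -/
  strat : ∀ i, CoalitionStructure ι K → Finset (A i)
  /-- Every player has at least one strategy. -/
  strat_nonempty : ∀ i, (strategySet strat i).Nonempty
  /-- The mechanism `R(K)`: it assigns to every strategy profile the realized coalition structure.
  The domains `S(P) = {s | mech s = P}` are disjoint and their union is `S(K)`. -/
  mech : StrategyProfile strat → CoalitionStructure ι K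
  /-- The payoff function `U_i(P) : S(P) → ℝ` of player `i` for the coalition structure `P`. -/
  payoff : ι → ∀ P : CoalitionStructure ι K, {s : StrategyProfile strat // mech s = P} → ℝ

namespace CoalitionGame

variable {ι : Type*} [Fintype ι] [DecidableEq ι] {A : ι → Type*} {K : ℕ}

/-- The pure strategy profiles `S(K)` of the game. -/
abbrev Profile (G : CoalitionGame ι A K) : Type _ := StrategyProfile G.strat

/-- The domain `S(P) ⊆ S(K)` of the coalition structure `P`. -/
abbrev Domain (G : CoalitionGame ι A K) (P : CoalitionStructure ι K) : Type _ :=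
  {s : G.Profile // G.mech s = P}

/-- `Δ_i(K)`: the probability distributions on the finite set `S_i(K)`. -/
abbrev MixedStrategy (G : CoalitionGame ι A K) (i : ι) : Type _ :=
  stdSimplex ℝ ↥(strategySet G.strat i)

/-- Profiles of mixed strategies, one for each player. -/
abbrev MixedProfile (G : CoalitionGame ι A K) : Type _ := ∀ i, G.MixedStrategy i

open Classical in
/-- The expected utility of player `i`, the players randomizing independently: the sum over the
realized coalition structures `P` and over the strategy profiles `s` in `S(P)` of the probability
of `s` times the payoff `U_i(P)(s)`. -/
noncomputable def expectedUtility (G : CoalitionGame ι A K) (i : ι) (σ : G.MixedProfile) : ℝ :=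
  ∑ P : CoalitionStructure ι K, ∑ s : G.Domain P,
    (∏ j, (σ j).1 (s.1 j)) * G.payoff i P s

/-- Equilibrium in `Γ(K)`: for every set `n` of at least one and at most `K` players, no player
`i ∈ n` gains by a deviation `τ ≠ σ i`, the other players keeping to `σ`. -/
def IsEquilibrium (G : CoalitionGame ι A K) (σ : G.MixedProfile) : Prop :=
  ∀ n : Finset ι, 1 ≤ n.card → n.card ≤ K → ∀ i ∈ n, ∀ τ : G.MixedStrategy i, τ ≠ σ i →
    G.expectedUtility i (Function.update σ i τ) ≤ G.expectedUtility i σ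

/-- `Γ(K) ⊆ Γ(L)` for `K ≤ L`: the larger game has the same strategy sets `S_i(P)` for all `P` in
`𝒫(K)`, and on the strategy profiles of the smaller game it has the same mechanism and payoffs. -/
structure IsNested {L : ℕ} (h : K ≤ L) (G : CoalitionGame ι A K) (H : CoalitionGame ι A L) :
    Prop where
  strat_eq : ∀ i P, H.strat i (P.incl h) = G.strat i P
  mech_eq : ∀ (s : G.Profile) (t : H.Profile), (∀ i, (s i : A i) = t i) →
    H.mech t = (G.mech s).incl h
  payoff_eq : ∀ i P (s : G.Domain P) (t : H.Domain (P.incl h)), (∀ j, (s.1 j : A j) = t.1 j) →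
    H.payoff i (P.incl h) t = G.payoff i P s

end CoalitionGame

/-- A nested family of games `Γ(1) ⊆ ⋯ ⊆ Γ(N)`, where `N` is the number of players. -/
structure NestedGameFamily (ι : Type*) [Fintype ι] [DecidableEq ι] (A : ι → Type*) where
  game : ∀ K : Set.Icc 1 (Fintype.card ι), CoalitionGame ι A K
  nested : ∀ (K L : Set.Icc 1 (Fintype.card ι)) (h : (K : ℕ) ≤ L),
    (game K).IsNested h (game L)

/-! A coalition `n` enters the equilibrium condition only through deviations of its single members,
so a mixed Nash equilibrium of each finite game suffices (`exists_nash_equilibrium`). Nash's theorem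
follows from Brouwer's: at a fixed point of the map that shifts weight towards strategies with
positive gain, nothing is left to gain. The product of simplices on which this map acts is a retract
of one simplex (`exists_fixedPoint_pi`).

Brouwer's theorem rests on Scarf's lemma (`exists_colorful`), a parity argument that needs no
triangulation. Applied to grid points ranked by each coordinate, with one slack point per
coordinate, it gives a small cluster that contains, for each `i`, a point `z` with `z i ≤ (f z) i`
up to a small error. Compactness removes the error, and equal coordinate sums turn `≤` into `=`. -/

namespace Scarf

/-! ### Scarf's combinatorial lemma -/

open Finset Function

variable {T I : Type*} [Fintype T] [DecidableEq T] [Fintype I] [DecidableEq I]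

/-- A finite set `σ` is dominant with respect to the rankings `r i` if every point lies weakly below
all of `σ` in at least one of the rankings. -/
def Dominant (r : I → T → ℕ) (σ : Finset T) : Prop :=
  ∀ y, ∃ i, ∀ x ∈ σ, r i y ≤ r i x

omit [Fintype T] [DecidableEq T] [Fintype I] [DecidableEq I] in
theorem Dominant.mono {r : I → T → ℕ} {σ τ : Finset T} (h : Dominant r σ) (hτ : τ ⊆ σ) :
    Dominant r τ := fun y => (h y).imp fun _ hi x hx => hi x (hτ hx)

omit [Fintype T] [DecidableEq T] [Fintype I] [DecidableEq I] in
theorem exists_argmin (r : I → T → ℕ) {σ : Finset T} (hσ : σ.Nonempty) :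
    ∃ m : I → T, (∀ i, m i ∈ σ) ∧ ∀ i, ∀ z ∈ σ, r i (m i) ≤ r i z := by
  choose m h1 h2 using fun i => exists_min_image σ (r i) hσ
  exact ⟨m, h1, h2⟩

-- Dominance tested at a point of `σ` itself makes that point minimal for some ranking.
omit [Fintype T] [DecidableEq I] in
theorem Dominant.image_argmin {r : I → T → ℕ} (hr : ∀ i, Injective (r i)) {σ : Finset T}
    (h : Dominant r σ) {m : I → T} (hm : ∀ i, m i ∈ σ) (hmin : ∀ i, ∀ z ∈ σ, r i (m i) ≤ r i z) :
    univ.image m = σ := by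
  ext x
  simp only [mem_image, mem_univ, true_and]
  refine ⟨?_, fun hx => ?_⟩
  · rintro ⟨i, rfl⟩
    exact hm i
  · obtain ⟨i, hi⟩ := h x
    exact ⟨i, hr i (le_antisymm (hmin i x hx) (hi _ (hm i)))⟩

omit [Fintype T] [DecidableEq I] in
/-- In a dominant set of full size no point is minimal for two rankings. -/
theorem Dominant.min_unique {r : I → T → ℕ} (hr : ∀ i, Injective (r i)) {σ : Finset T}
    (h : Dominant r σ) (hcard : #σ = Fintype.card I) {x : T} (hx : x ∈ σ) {k l : I}
    (hk : ∀ z ∈ σ, r k x ≤ r k z) (hl : ∀ z ∈ σ, r l x ≤ r l z) : k = l := by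
  obtain ⟨m, hm, hmin⟩ := exists_argmin r ⟨x, hx⟩
  have him := h.image_argmin hr hm hmin
  -- `m` maps onto `σ`, which has as many points as there are rankings.
  have hinj : Set.InjOn m (univ : Finset I) := by
    apply card_image_iff.1
    rw [him, hcard, card_univ]
  refine hinj (by simp) (by simp) ?_
  rw [hr k (le_antisymm (hmin k x hx) (hk _ (hm k))), hr l (le_antisymm (hmin l x hx) (hl _ (hm l)))]

omit [DecidableEq I] in
/-- A dominant set can be completed in exactly one way by a point that becomes minimal for the
ranking `k`, if its other minima already exhaust it. -/
theorem Dominant.existsUnique_insert {r : I → T → ℕ} (hr : ∀ i, Injective (r i)) {τ : Finset T}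
    (h : Dominant r τ) (hcard : #τ + 1 = Fintype.card I) {m : I → T} (hm : ∀ i, m i ∈ τ)
    (hmin : ∀ i, ∀ z ∈ τ, r i (m i) ≤ r i z) (k : I) (hk : ∀ x ∈ τ, ∃ l, l ≠ k ∧ m l = x)
    (hM : ∃ y, ∀ l, l ≠ k → r l (m l) < r l y) :
    ∃! y, y ∉ τ ∧ Dominant r (insert y τ) ∧ r k y < r k (m k) := by
  classical
  -- Among the points above `m l` for all `l ≠ k`, the completion must be the highest for `k`: any
  -- other choice fails dominance at the highest.
  obtain ⟨y, hy, hymax⟩ := exists_max_image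
    (univ.filter fun y => ∀ l, l ≠ k → r l (m l) < r l y) (r k)
    (by obtain ⟨y, hy⟩ := hM; exact ⟨y, by simpa using hy⟩)
  simp only [mem_filter, mem_univ, true_and] at hy hymax
  have hyτ : y ∉ τ := by
    intro hyτ
    obtain ⟨l, hl, rfl⟩ := hk y hyτ
    exact lt_irrefl _ (hy l hl)
  have hlt : r k y < r k (m k) := by
    obtain ⟨i, hi⟩ := h y
    by_cases hik : i = k
    · subst hik
      refine lt_of_le_of_ne (hi _ (hm i)) fun he => hyτ ?_
      rw [hr i he]
      exact hm i
    · exact absurd (hi _ (hm i)) (not_le.2 (hy i hik))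
  refine ⟨y, ⟨hyτ, fun z => ?_, hlt⟩, ?_⟩
  · by_cases hz : ∀ l, l ≠ k → r l (m l) < r l z
    · refine ⟨k, fun x hx => ?_⟩
      obtain rfl | hx := mem_insert.1 hx
      · exact hymax z hz
      · exact (hymax z hz).trans (hlt.le.trans (hmin k x hx))
    · push Not at hz
      obtain ⟨l, hl, hz⟩ := hz
      refine ⟨l, fun x hx => ?_⟩
      obtain rfl | hx := mem_insert.1 hx
      · exact hz.trans (hy l hl).le
      · exact hz.trans (hmin l x hx)
  · rintro w ⟨hwτ, hwd, hwk⟩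
    have hwM : ∀ l, l ≠ k → r l (m l) < r l w := by
      intro l hl
      by_contra hlt
      push Not at hlt
      refine hl (hwd.min_unique hr (by rw [card_insert_of_notMem hwτ, hcard])
        (mem_insert_self w τ) (fun z hz => ?_) (fun z hz => ?_))
      · obtain rfl | hz := mem_insert.1 hz
        · exact le_rfl
        · exact hlt.trans (hmin l z hz)
      · obtain rfl | hz := mem_insert.1 hz
        · exact le_rfl
        · exact hwk.le.trans (hmin k z hz)
    refine hr k (le_antisymm (hymax w hwM) ?_)
    obtain ⟨i, hi⟩ := hwd y
    by_cases hik : i = k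
    · subst hik
      exact hi _ (mem_insert_self _ _)
    · exact absurd (hi _ (mem_insert_of_mem (hm i))) (not_le.2 (hy i hik))

-- The rankings outnumber `τ` by one and their minima exhaust it, so exactly one pair `i ≠ j` shares
-- a minimum. A completion takes over the minimum for exactly one of the two, and each choice is
-- realised once.
open Classical in
omit [DecidableEq I] in
theorem Dominant.card_insert_eq_two {r : I → T → ℕ} (hr : ∀ i, Injective (r i)) {τ : Finset T}
    (h : Dominant r τ) (hcard : #τ + 1 = Fintype.card I) {x₀ : T} (hx₀ : x₀ ∈ τ)
    (hM : ∀ k, ∃ y, ∀ l, l ≠ k → r l x₀ < r l y) :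
    #{y | y ∉ τ ∧ Dominant r (insert y τ)} = 2 := by
  obtain ⟨m, hm, hmin⟩ := exists_argmin r ⟨x₀, hx₀⟩
  have him := h.image_argmin hr hm hmin
  obtain ⟨i, -, j, -, hij, hmij⟩ : ∃ i ∈ (univ : Finset I), ∃ j ∈ (univ : Finset I),
      i ≠ j ∧ m i = m j :=
    exists_ne_map_eq_of_card_lt_of_maps_to (t := τ) (by rw [card_univ]; omega) fun i _ => hm i
  have key : ∀ a b, a ≠ b → m a = m b →
      ∃! y, y ∉ τ ∧ Dominant r (insert y τ) ∧ r a y < r a (m a) := by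
    intro a b hab hmab
    refine h.existsUnique_insert hr hcard hm hmin a (fun x hx => ?_) ?_
    · rw [← him] at hx
      obtain ⟨l, -, rfl⟩ := mem_image.1 hx
      by_cases hl : l = a
      · exact ⟨b, hab.symm, by rw [hl, hmab]⟩
      · exact ⟨l, hl, rfl⟩
    · obtain ⟨y, hy⟩ := hM a
      exact ⟨y, fun l hl => (hmin l _ hx₀).trans_lt (hy l hl)⟩
  have uniq : ∀ y, y ∉ τ → Dominant r (insert y τ) → ∀ k l, r k y < r k (m k) →
      r l y < r l (m l) → k = l := by
    intro y hy hd k l hk hl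
    refine hd.min_unique hr (by rw [card_insert_of_notMem hy, hcard])
        (mem_insert_self y τ) (fun z hz => ?_) (fun z hz => ?_)
    · obtain rfl | hz := mem_insert.1 hz
      · exact le_rfl
      · exact hk.le.trans (hmin k z hz)
    · obtain rfl | hz := mem_insert.1 hz
      · exact le_rfl
      · exact hl.le.trans (hmin l z hz)
  obtain ⟨y, ⟨hy, hyd, hyi⟩, hyu⟩ := key i j hij hmij
  obtain ⟨z, ⟨hz, hzd, hzj⟩, hzu⟩ := key j i hij.symm hmij.symm
  rw [card_eq_two]
  refine ⟨y, z, ?_, ?_⟩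
  · rintro rfl
    exact hij (uniq y hy hyd i j hyi hzj)
  · ext w
    simp only [mem_filter, mem_univ, true_and, mem_insert, mem_singleton]
    refine ⟨?_, ?_⟩
    · rintro ⟨hw, hwd⟩
      by_cases hwi : r i w < r i (m i)
      · exact Or.inl (hyu w ⟨hw, hwd, hwi⟩)
      by_cases hwj : r j w < r j (m j)
      · exact Or.inr (hzu w ⟨hw, hwd, hwj⟩)
      refine absurd (hwd.min_unique hr (by rw [card_insert_of_notMem hw, hcard])
        (mem_insert_of_mem (hm i)) (fun v hv => ?_) (fun v hv => ?_)) hij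
      · obtain rfl | hv := mem_insert.1 hv
        · exact not_lt.1 hwi
        · exact hmin i v hv
      · rw [hmij]
        obtain rfl | hv := mem_insert.1 hv
        · exact not_lt.1 hwj
        · exact hmin j v hv
    · rintro (rfl | rfl)
      · exact ⟨hy, hyd⟩
      · exact ⟨hz, hzd⟩

open Classical in
/-- The facet spanned by all slack points but one has exactly one completion. -/
theorem card_insert_slack_eq_one {r : I → T → ℕ} (hr : ∀ i, Injective (r i)) {s : I → T}
    (hs : Injective s) (hmin : ∀ i y, r i (s i) ≤ r i y)
    (hmax : ∀ i m, m ≠ i → ∀ y ∉ Set.range s, r i y < r i (s m)) (i₀ : I) :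
    #{y | y ∉ (univ.erase i₀).image s ∧ Dominant r (insert y ((univ.erase i₀).image s))} = 1 := by
  set τ := (univ.erase i₀).image s with hτ
  have hs0 : s i₀ ∉ τ := by simp [hτ, hs.eq_iff]
  have hsm : ∀ m, m ≠ i₀ → s m ∈ τ := fun m hm => mem_image_of_mem s (by simpa using hm)
  have hcase : ∀ z, z ∉ τ → z = s i₀ ∨ z ∉ Set.range s := by
    intro z hz
    by_contra! hc
    obtain ⟨m, rfl⟩ := hc.2
    exact hz (hsm m fun hm => hc.1 (by rw [hm]))
  obtain ⟨y, hy, hymax⟩ := exists_max_image (univ.filter fun y => y ∉ τ) (r i₀)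
    ⟨s i₀, by simpa using hs0⟩
  simp only [mem_filter, mem_univ, true_and] at hy hymax
  rw [card_eq_one]
  refine ⟨y, ?_⟩
  ext w
  simp only [mem_filter, mem_univ, true_and, mem_singleton]
  refine ⟨?_, ?_⟩
  · rintro ⟨hw, hwd⟩
    refine hr i₀ (le_antisymm (hymax w hw) ?_)
    -- Only `i = i₀` is possible: for `i ≠ i₀` nothing but `s i` lies weakly below `s i`.
    obtain ⟨i, hi⟩ := hwd y
    by_cases hii : i = i₀
    · subst hii
      exact hi _ (mem_insert_self _ _)
    · have h1 := hi _ (mem_insert_of_mem (hsm i hii))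
      have h2 : y = s i := hr i (le_antisymm h1 (hmin i y))
      exact absurd (h2 ▸ hsm i hii) hy
  · rintro rfl
    refine ⟨hy, fun z => ?_⟩
    by_cases hz : z ∈ τ
    · obtain ⟨m, -, rfl⟩ := mem_image.1 hz
      exact ⟨m, fun x _ => hmin m x⟩
    · refine ⟨i₀, fun x hx => ?_⟩
      obtain rfl | hx := mem_insert.1 hx
      · exact hymax z hz
      · obtain ⟨m, hm, rfl⟩ := mem_image.1 hx
        have hm : m ≠ i₀ := by simpa using hm
        obtain rfl | hz := hcase z hz
        · exact hmin i₀ _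
        · exact (hmax i₀ m hm z hz).le

-- If removing `x` leaves each color but `i₀` exactly once, the color of `x` recurs at a single
-- `x'`, and only `x` and `x'` can be so removed.
omit [Fintype T] in
theorem even_card_erase {c : T → I} {σ : Finset T} (hcard : #σ = Fintype.card I)
    (hσ : σ.image c ≠ univ) (i₀ : I) :
    Even #{x ∈ σ | (σ.erase x).image c = univ.erase i₀} := by
  obtain he | ⟨x, hx⟩ := (σ.filter fun x => (σ.erase x).image c = univ.erase i₀).eq_empty_or_nonempty
  · rw [he]; simp
  obtain ⟨hxσ, hxc⟩ := mem_filter.1 hx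
  have hinj : Set.InjOn c (σ.erase x : Finset T) := by
    apply card_image_iff.1
    rw [hxc, card_erase_of_mem hxσ, hcard, card_erase_of_mem (mem_univ _), card_univ]
  have hxi : c x ≠ i₀ := by
    intro h
    apply hσ
    rw [← insert_erase hxσ, image_insert, hxc, h, insert_erase (mem_univ _)]
  have : c x ∈ (σ.erase x).image c := by rw [hxc]; simpa using hxi
  obtain ⟨x', hx', hcx⟩ := mem_image.1 this
  obtain ⟨hne, hx'σ⟩ := mem_erase.1 hx'
  suffices hset : {x ∈ σ | (σ.erase x).image c = univ.erase i₀} = {x, x'} by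
    rw [hset, card_pair hne.symm]; exact even_two
  ext z
  simp only [mem_filter, mem_insert, mem_singleton]
  refine ⟨?_, ?_⟩
  · rintro ⟨hzσ, hz⟩
    by_cases hzx : z = x
    · exact Or.inl hzx
    right
    have hz' : z ∈ σ.erase x := mem_erase.2 ⟨hzx, hzσ⟩
    have : c z ∈ (σ.erase z).image c := by rw [hz, ← hxc]; exact mem_image_of_mem c hz'
    obtain ⟨w, hw, hcw⟩ := mem_image.1 this
    obtain ⟨hwz, hwσ⟩ := mem_erase.1 hw
    by_cases hwx : w = x
    · subst hwx
      exact hinj hz' hx' (by rw [← hcw, hcx])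
    · exact absurd (hinj (mem_coe.2 (mem_erase.2 ⟨hwx, hwσ⟩)) hz' hcw) hwz
  · rintro (rfl | rfl)
    · exact ⟨hxσ, hxc⟩
    · refine ⟨hx'σ, ?_⟩
      rw [← hxc]
      ext d
      simp only [mem_image, mem_erase]
      refine ⟨?_, ?_⟩
      · rintro ⟨w, ⟨_, hwσ⟩, rfl⟩
        by_cases hwx : w = x
        · exact ⟨z, ⟨hne, hx'σ⟩, by rw [hcx, hwx]⟩
        · exact ⟨w, ⟨hwx, hwσ⟩, rfl⟩
      · rintro ⟨w, ⟨_, hwσ⟩, rfl⟩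
        by_cases hwx : w = z
        · exact ⟨x, ⟨hne.symm, hxσ⟩, by rw [hwx, hcx]⟩
        · exact ⟨w, ⟨hwx, hwσ⟩, rfl⟩

/-- **Scarf's lemma**: there is a dominant set of full size that carries all colors. -/
theorem exists_colorful [Nonempty I] {r : I → T → ℕ} (hr : ∀ i, Injective (r i)) {s : I → T}
    (hs : Injective s) (hmin : ∀ i y, r i (s i) ≤ r i y)
    (hmax : ∀ i m, m ≠ i → ∀ y ∉ Set.range s, r i y < r i (s m)) {c : T → I}
    (hc : ∀ i, c (s i) = i) :
    ∃ σ : Finset T, #σ = Fintype.card I ∧ Dominant r σ ∧ σ.image c = univ := by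
  classical
  by_contra! hno
  obtain ⟨i₀⟩ := ‹Nonempty I›
  have hI : 0 < Fintype.card I := Fintype.card_pos_iff.2 ⟨i₀⟩
  -- Incident pairs of a door and a room are counted twice: under `hno` each room has evenly many
  -- doors, while each door lies in two rooms, except `τ₀`, which lies in one.
  let rooms : Finset (Finset T) := {σ | #σ = Fintype.card I ∧ Dominant r σ}
  let doors : Finset (Finset T) :=
    {τ | #τ + 1 = Fintype.card I ∧ Dominant r τ ∧ τ.image c = univ.erase i₀}
  have hcount : #(doors.sigma fun τ => ({y | y ∉ τ ∧ Dominant r (insert y τ)} : Finset T)) =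
      #(rooms.sigma fun σ => {x ∈ σ | (σ.erase x).image c = univ.erase i₀}) := by
    refine card_bij' (fun p _ => ⟨insert p.2 p.1, p.2⟩) (fun p _ => ⟨p.1.erase p.2, p.2⟩)
      ?_ ?_ ?_ ?_
    · rintro ⟨τ, y⟩ h
      simp only [doors, rooms, mem_sigma, mem_filter, mem_univ, true_and] at h ⊢
      obtain ⟨⟨h1, h2, h3⟩, h4, h5⟩ := h
      exact ⟨⟨by rw [card_insert_of_notMem h4, h1], h5⟩, mem_insert_self _ _,
        by rw [erase_insert h4, h3]⟩
    · rintro ⟨σ, x⟩ h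
      simp only [doors, rooms, mem_sigma, mem_filter, mem_univ, true_and] at h ⊢
      obtain ⟨⟨h1, h2⟩, h3, h4⟩ := h
      refine ⟨⟨by rw [card_erase_add_one h3, h1], h2.mono (erase_subset _ _), h4⟩,
        notMem_erase _ _, by rwa [insert_erase h3]⟩
    · rintro ⟨τ, y⟩ h
      simp only [mem_sigma, mem_filter, mem_univ, true_and] at h
      simp [erase_insert h.2.1]
    · rintro ⟨σ, x⟩ h
      simp only [mem_sigma, mem_filter] at h
      simp [insert_erase h.2.1]
  rw [card_sigma, card_sigma] at hcount
  have heven : Even (∑ σ ∈ rooms, #{x ∈ σ | (σ.erase x).image c = univ.erase i₀}) := by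
    refine even_sum _ fun σ hσ => ?_
    obtain ⟨h1, h2⟩ := (mem_filter.1 hσ).2
    exact even_card_erase h1 (hno σ h1 h2) i₀
  set τ₀ := (univ.erase i₀).image s with hτ₀
  have hone := card_insert_slack_eq_one hr hs hmin hmax i₀
  have hτ₀d : τ₀ ∈ doors := by
    obtain ⟨y, hy⟩ := card_pos.1 (hone.symm ▸ one_pos)
    simp only [mem_filter, mem_univ, true_and] at hy
    simp only [doors, mem_filter, mem_univ, true_and]
    refine ⟨?_, hy.2.mono (subset_insert _ _), ?_⟩
    · rw [hτ₀, card_image_of_injective _ hs, card_erase_of_mem (mem_univ _), card_univ]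
      omega
    · rw [hτ₀, image_image, show c ∘ s = id from funext hc, image_id]
  rw [← hcount, ← add_sum_erase _ _ hτ₀d, hone, sum_congr rfl (g := fun _ => 2), sum_const] at heven
  · simp [Nat.even_add] at heven
  intro τ hτ
  obtain ⟨hne, hτ⟩ := mem_erase.1 hτ
  obtain ⟨h1, h2, h3⟩ := (mem_filter.1 hτ).2
  -- A door made of slack points alone would be `τ₀`, since `s m` has color `m`.
  obtain ⟨x₀, hx₀, hx₀s⟩ : ∃ x ∈ τ, x ∉ Set.range s := by
    by_contra! hall
    refine hne (eq_of_subset_of_card_le (fun x hx => ?_) ?_)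
    · obtain ⟨m, rfl⟩ := hall x hx
      refine mem_image_of_mem s ?_
      rw [← h3, ← hc m]
      simpa [hc] using mem_image_of_mem c hx
    · rw [hτ₀, card_image_of_injective _ hs, card_erase_of_mem (mem_univ _), card_univ]
      omega
  exact h2.card_insert_eq_two hr h1 hx₀ fun k => ⟨s k, fun l hl => hmax l k hl.symm _ hx₀s⟩

end Scarf

/-! ### Clusters of grid points -/

open Finset Function

/-- Let `C` be the indices whose slack points are missing from Scarf's set. By dominance no grid
point exceeds the cluster's minima `m` on all of `C`, so these minima sum to more than `N - #C`.
Little is then left to distribute, which forces closeness on `C` and small coordinates off `C`. -/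
theorem exists_clustered_grid_points {I : Type*} [Fintype I] [DecidableEq I] [Nonempty I] (N : ℕ)
    (c : ↥(piAntidiag (univ : Finset I) N) → I) :
    ∃ σ : Finset ↥(piAntidiag (univ : Finset I) N), σ.Nonempty ∧
      (∀ p ∈ σ, ∀ q ∈ σ, ∀ i, p.1 i ≤ q.1 i + Fintype.card I) ∧
      ∀ i, (∃ p ∈ σ, c p = i) ∨ ∀ p ∈ σ, p.1 i ≤ Fintype.card I := by
  classical
  have hsum : ∀ p : ↥(piAntidiag (univ : Finset I) N), ∑ i, p.1 i = N := fun p =>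
    (mem_piAntidiag.1 p.2).1
  have hle : ∀ (p : ↥(piAntidiag (univ : Finset I) N)) i, p.1 i ≤ N := fun p i =>
    (single_le_sum (f := p.1) (fun _ _ => Nat.zero_le _) (mem_univ i)).trans (hsum p).le
  have hpart : ∀ (p : ↥(piAntidiag (univ : Finset I) N)) (s : Finset I), ∑ i ∈ s, p.1 i ≤ N :=
    fun p s => (sum_le_sum_of_subset (subset_univ _)).trans (hsum p).le
  set M := Fintype.card ↥(piAntidiag (univ : Finset I) N)
  let e := Fintype.equivFin ↥(piAntidiag (univ : Finset I) N)
  let b := Fintype.equivFin I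
  -- Ranking `i` puts its own slack point lowest and the other slack points above the grid; `e` and
  -- `b` break ties, and the factor `M` lets the coordinate prevail over `e`.
  let r : I → ↥(piAntidiag (univ : Finset I) N) ⊕ I → ℕ := fun i => Sum.elim
    (fun p => 1 + (p.1 i * M + e p)) (fun m => if m = i then 0 else 1 + ((N + 1) * M + b m))
  have hlt : ∀ (p : ↥(piAntidiag (univ : Finset I) N)) i, p.1 i * M + e p < (N + 1) * M := by
    intro p i
    have h1 := Nat.mul_le_mul_right M (hle p i)
    have h2 := (e p).2
    rw [add_mul, one_mul]
    omega
  have hr : ∀ i, Injective (r i) := by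
    rintro i (p | m) (q | k) h
    · simp only [r, Sum.elim_inl, add_right_inj] at h
      have h2 := congrArg (· % M) h
      have hp : (e p : ℕ) < M := (e p).2
      have hq : (e q : ℕ) < M := (e q).2
      simp only [Nat.mul_add_mod_self_right, Nat.mod_eq_of_lt hp, Nat.mod_eq_of_lt hq] at h2
      rw [e.injective (Fin.ext h2)]
    · have := hlt p i
      simp only [r, Sum.elim_inl, Sum.elim_inr] at h
      split_ifs at h <;> omega
    · have := hlt q i
      simp only [r, Sum.elim_inl, Sum.elim_inr] at h
      split_ifs at h <;> omega
    · simp only [r, Sum.elim_inr] at h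
      split_ifs at h with h1 h2 h2
      · rw [h1, h2]
      · omega
      · omega
      · rw [b.injective (Fin.ext (by omega : (b m : ℕ) = b k))]
  have hmax : ∀ i m, m ≠ i → ∀ y ∉ Set.range (Sum.inr : I → _), r i y < r i (Sum.inr m) := by
    rintro i m hm (p | k) hy
    · have := hlt p i
      simp only [r, Sum.elim_inl, Sum.elim_inr, if_neg hm]
      omega
    · exact absurd ⟨k, rfl⟩ hy
  obtain ⟨σ', -, hdom, hcol⟩ := Scarf.exists_colorful (c := Sum.elim c id) hr
    Sum.inr_injective (by simp [r]) hmax (by simp)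
  set σ : Finset ↥(piAntidiag (univ : Finset I) N) := {p | Sum.inl p ∈ σ'} with hσ
  have hmem : ∀ p, p ∈ σ ↔ Sum.inl p ∈ σ' := by simp [hσ]
  have hD : ∀ y : ↥(piAntidiag (univ : Finset I) N),
      ∃ i, Sum.inr i ∉ σ' ∧ ∀ p ∈ σ, y.1 i ≤ p.1 i := by
    intro y
    obtain ⟨i, hi⟩ := hdom (Sum.inl y)
    refine ⟨i, fun h => ?_, fun p hp => ?_⟩
    · have := hi _ h
      simp [r] at this
    · have h1 := hi _ ((hmem p).1 hp)
      simp only [r, Sum.elim_inl, add_le_add_iff_left] at h1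
      by_contra! h2
      have h3 := Nat.mul_le_mul_right M (Nat.succ_le_of_lt h2)
      have h4 := (e p).2
      rw [Nat.succ_mul] at h3
      omega
  have hcolor : ∀ i, Sum.inr i ∉ σ' → ∃ p ∈ σ, c p = i := by
    intro i hi
    have : i ∈ σ'.image (Sum.elim c id) := by rw [hcol]; exact mem_univ i
    obtain ⟨p | k, hx, h⟩ := mem_image.1 this
    · exact ⟨p, (hmem p).2 hx, h⟩
    · exact absurd (show k = i from h) (by rintro rfl; exact hi hx)
  have hne : σ.Nonempty := by
    obtain ⟨j⟩ := ‹Nonempty I›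
    -- Any grid point would serve: some slack point is missing, so its color must come from the
    -- grid.
    obtain ⟨i, hi, -⟩ := hD ⟨Pi.single j N, by simp [mem_piAntidiag]⟩
    obtain ⟨p, hp, -⟩ := hcolor i hi
    exact ⟨p, hp⟩
  choose P hPσ hPmin using fun i => exists_min_image σ (fun p => p.1 i) hne
  let m : I → ℕ := fun i => (P i).1 i
  set C : Finset I := {i | Sum.inr i ∉ σ'} with hC
  have hbig : N < ∑ i ∈ C, (m i + 1) := by
    by_contra! hsm
    obtain ⟨i₀, hi₀, -⟩ := hD (P (Classical.arbitrary I))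
    have hi₀C : i₀ ∈ C := by simpa [hC] using hi₀
    -- Each minimum over `C` is raised by one; the remainder goes to `i₀` to reach the sum `N`.
    obtain ⟨i, hi, hy⟩ := hD ⟨fun i => (if i ∈ C then m i + 1 else 0) +
      (Pi.single i₀ (N - ∑ i ∈ C, (m i + 1)) : I → ℕ) i, by
        simp only [mem_piAntidiag, mem_univ, implies_true, and_true]
        rw [sum_add_distrib, sum_ite_mem, univ_inter]
        simp only [sum_pi_single', mem_univ, if_true]
        omega⟩
    have hiC : i ∈ C := by simpa [hC] using hi
    have : _ ≤ m i := hy (P i) (hPσ i)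
    simp only [if_pos hiC] at this
    omega
  rw [sum_add_distrib, sum_const, smul_eq_mul, mul_one] at hbig
  have hCcard : #C ≤ Fintype.card I := card_le_univ C
  have hup : ∀ p ∈ σ, ∀ i, i ∉ C → p.1 i ≤ Fintype.card I := by
    intro p hp i hi
    have h1 : p.1 i + ∑ j ∈ C, p.1 j ≤ N := by
      rw [← sum_insert hi]
      exact hpart p _
    have h2 : ∑ j ∈ C, m j ≤ ∑ j ∈ C, p.1 j := sum_le_sum fun j _ => hPmin j p hp
    omega
  refine ⟨σ, hne, fun p hp q hq i => ?_, fun i => ?_⟩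
  · by_cases hi : i ∈ C
    · have h1 : p.1 i + ∑ j ∈ C.erase i, p.1 j ≤ N := by
        rw [add_sum_erase C p.1 hi]
        exact hpart p _
      have h2 : ∑ j ∈ C.erase i, m j ≤ ∑ j ∈ C.erase i, p.1 j :=
        sum_le_sum fun j _ => hPmin j p hp
      have h3 := add_sum_erase C m hi
      have h4 : m i ≤ q.1 i := hPmin i q hq
      omega
    · exact (hup p hp i hi).trans (Nat.le_add_left _ _)
  · by_cases hi : i ∈ C
    · exact Or.inl (hcolor i (by simpa [hC] using hi))
    · exact Or.inr fun p hp => hup p hp i hi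

/-! ### Brouwer's theorem on the simplex -/

namespace stdSimplex

variable {I : Type*} [Fintype I]

/-- Each grid point is colored by a coordinate that `f` does not decrease. A color absent from the
cluster belongs to a coordinate at most `ε` there, where the claim is trivial. -/
theorem exists_near_le_apply [Nonempty I] (f : stdSimplex ℝ I → stdSimplex ℝ I) {ε : ℝ}
    (hε : 0 < ε) : ∃ x : stdSimplex ℝ I, ∀ i, ∃ z : stdSimplex ℝ I,
      dist z x ≤ ε ∧ z.1 i ≤ (f z).1 i + ε := by
  classical
  obtain ⟨N, hN⟩ := exists_nat_gt (Fintype.card I / ε)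
  have hN0 : (0 : ℝ) < N := lt_of_le_of_lt (by positivity) hN
  have hNε : (Fintype.card I : ℝ) / N ≤ ε := by
    rw [div_le_iff₀ hN0]
    rw [div_lt_iff₀ hε] at hN
    linarith
  let pt : ↥(piAntidiag (univ : Finset I) N) → stdSimplex ℝ I := fun p =>
    ⟨fun i => p.1 i / N, fun i => by positivity, by
      rw [← sum_div, ← Nat.cast_sum, (mem_piAntidiag.1 p.2).1, div_self hN0.ne']⟩
  have hcol : ∀ p, ∃ i, (pt p).1 i ≤ (f (pt p)).1 i := by
    intro p
    obtain ⟨i, -, hi⟩ := exists_le_of_sum_le (s := (univ : Finset I)) univ_nonempty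
      (((pt p).2.2.trans (f (pt p)).2.2.symm).le)
    exact ⟨i, hi⟩
  choose c hc using hcol
  obtain ⟨σ, ⟨q, hq⟩, hclose, hcol⟩ := exists_clustered_grid_points N c
  have hdist : ∀ p ∈ σ, dist (pt p) (pt q) ≤ ε := by
    intro p hp
    refine (dist_pi_le_iff hε.le).2 fun i => ?_
    have h1 : (p.1 i : ℝ) ≤ q.1 i + Fintype.card I := by exact_mod_cast hclose p hp q hq i
    have h2 : (q.1 i : ℝ) ≤ p.1 i + Fintype.card I := by exact_mod_cast hclose q hq p hp i
    refine le_trans ?_ hNε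
    change |(p.1 i : ℝ) / N - q.1 i / N| ≤ _
    rw [← sub_div, abs_div, abs_of_pos hN0]
    gcongr
    rw [abs_le]
    constructor <;> linarith
  refine ⟨pt q, fun i => ?_⟩
  obtain ⟨p, hp, rfl⟩ | h := hcol i
  · exact ⟨pt p, hdist p hp, (hc p).trans (le_add_of_nonneg_right hε.le)⟩
  · refine ⟨pt q, by simpa using hε.le, ?_⟩
    have h1 : (q.1 i : ℝ) ≤ Fintype.card I := by exact_mod_cast h q hq
    have h2 : (pt q).1 i ≤ ε := (div_le_div_of_nonneg_right h1 hN0.le).trans hNε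
    linarith [(f (pt q)).2.1 i]

/-- Uniform continuity carries the estimates at the various `z` to the common `x`; the thirds of `ε`
pay for `x` to `z`, `z` to `f z`, and `f z` to `f x`. -/
theorem exists_le_apply_add [Nonempty I] {f : stdSimplex ℝ I → stdSimplex ℝ I} (hf : Continuous f)
    {ε : ℝ} (hε : 0 < ε) : ∃ x : stdSimplex ℝ I, ∀ i, x.1 i ≤ (f x).1 i + ε := by
  obtain ⟨δ, hδ, hfδ⟩ := Metric.uniformContinuous_iff.1
    (CompactSpace.uniformContinuous_of_continuous hf) (ε / 3) (by positivity)
  obtain ⟨x, hx⟩ := exists_near_le_apply f (ε := min (δ / 2) (ε / 3)) (by positivity)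
  refine ⟨x, fun i => ?_⟩
  obtain ⟨z, hzx, hz⟩ := hx i
  have h1 := (dist_le_pi_dist z.1 x.1 i).trans (hzx.trans (min_le_right _ _))
  have h2 := (dist_le_pi_dist (f z).1 (f x).1 i).trans
    (hfδ (lt_of_le_of_lt (hzx.trans (min_le_left _ _)) (half_lt_self hδ))).le
  rw [Real.dist_eq, abs_le] at h1 h2
  have h3 := min_le_right (δ / 2) (ε / 3)
  linarith

/-- **Brouwer's fixed point theorem** for the standard simplex. -/
theorem exists_fixedPoint [Nonempty I] {f : stdSimplex ℝ I → stdSimplex ℝ I} (hf : Continuous f) :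
    ∃ x, f x = x := by
  -- The total excess of `x` over `f x`: its minimum is attained, and approximate solutions force it
  -- to be zero.
  let g : stdSimplex ℝ I → ℝ := fun x => ∑ i, max 0 (x.1 i - (f x).1 i)
  have hg : Continuous g := by
    have h (i : I) : Continuous fun x : stdSimplex ℝ I => x.1 i :=
      (continuous_apply i).comp continuous_subtype_val
    exact continuous_finsetSum _ fun i _ => continuous_const.max ((h i).sub ((h i).comp hf))
  have : Nonempty (stdSimplex ℝ I) := by
    obtain ⟨x, -⟩ := exists_le_apply_add hf one_pos
    exact ⟨x⟩
  obtain ⟨x, -, hx⟩ := isCompact_univ.exists_isMinOn (s := (Set.univ : Set (stdSimplex ℝ I)))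
    Set.univ_nonempty hg.continuousOn
  have hx0 : g x ≤ 0 := by
    refine le_of_forall_pos_le_add fun ε hε => ?_
    have hI : (0 : ℝ) < Fintype.card I := by exact_mod_cast Fintype.card_pos
    obtain ⟨y, hy⟩ := exists_le_apply_add hf (ε := ε / Fintype.card I) (by positivity)
    calc g x ≤ g y := hx (Set.mem_univ y)
      _ ≤ ∑ _i : I, ε / Fintype.card I := by
          refine sum_le_sum fun i _ => max_le (by positivity) ?_
          linarith [hy i]
      _ = 0 + ε := by rw [sum_const, card_univ, nsmul_eq_mul]; field_simp; ring
  have hle : ∀ i, x.1 i ≤ (f x).1 i := by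
    intro i
    have h1 := single_le_sum (f := fun i => max 0 (x.1 i - (f x).1 i))
      (fun i _ => le_max_left _ _) (mem_univ i)
    have h2 := le_max_right 0 (x.1 i - (f x).1 i)
    have h3 : ∑ i, max 0 (x.1 i - (f x).1 i) ≤ 0 := hx0
    linarith
  refine ⟨x, Subtype.ext (funext fun i => ?_)⟩
  exact ((sum_eq_sum_iff_of_le fun i _ => hle i).1 (x.2.2.trans (f x).2.2.symm) i
    (mem_univ i)).symm

end stdSimplex

/-! ### Fixed points on products of simplices -/

open Finset Function

namespace stdSimplex

/-- The point of the standard simplex with weights proportional to `q`. -/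
noncomputable def normalize {I : Type*} [Fintype I] (q : I → ℝ) (h0 : ∀ i, 0 ≤ q i)
    (hs : 0 < ∑ i, q i) : stdSimplex ℝ I :=
  ⟨fun i => q i / ∑ j, q j, fun i => div_nonneg (h0 i) hs.le, by rw [← sum_div, div_self hs.ne']⟩

theorem continuous_normalize {X I : Type*} [TopologicalSpace X] [Fintype I] {q : X → I → ℝ}
    (hq : ∀ i, Continuous fun x => q x i) (h0 : ∀ x i, 0 ≤ q x i) (hs : ∀ x, 0 < ∑ i, q x i) :
    Continuous fun x => normalize (q x) (h0 x) (hs x) :=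
  Continuous.subtype_mk (continuous_pi fun i =>
    (hq i).div (continuous_finsetSum _ fun j _ => hq j) fun x => (hs x).ne') _

theorem continuous_coord {I : Type*} [Fintype I] (i : I) :
    Continuous fun x : stdSimplex ℝ I => x.1 i :=
  (continuous_apply i).comp continuous_subtype_val

variable {ι : Type*} [Fintype ι] {S : ι → Type*} [∀ i, Fintype (S i)]

omit [Fintype ι] in
theorem continuous_pi_coord (i : ι) (a : S i) :
    Continuous fun σ : ∀ i, stdSimplex ℝ (S i) => (σ i).1 a :=
  (continuous_coord a).comp (continuous_apply i)

/-- Brouwer's fixed point theorem for a product of standard simplices, which is a retract of a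
single standard simplex. -/
theorem exists_fixedPoint_pi [Nonempty ι] [∀ i, Nonempty (S i)]
    {h : (∀ i, stdSimplex ℝ (S i)) → ∀ i, stdSimplex ℝ (S i)} (hh : Continuous h) :
    ∃ σ, h σ = σ := by
  have hn : (0 : ℝ) < Fintype.card ι := by exact_mod_cast Fintype.card_pos
  -- Blocks of embedded points have mass `1 / Fintype.card ι`, so the slack vanishes there;
  -- elsewhere it keeps an empty block normalizable.
  let slack (p : stdSimplex ℝ (Σ i, S i)) (i : ι) : ℝ :=
    max 0 (1 / Fintype.card ι - ∑ b, p.1 ⟨i, b⟩)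
  have hslack : ∀ p i, 0 ≤ slack p i := fun p i => le_max_left _ _
  have hpos : ∀ (p : stdSimplex ℝ (Σ i, S i)) (i : ι), 0 < ∑ a, (p.1 ⟨i, a⟩ + slack p i) := by
    intro p i
    have hm : 0 ≤ ∑ b, p.1 ⟨i, b⟩ := sum_nonneg fun b _ => p.2.1 _
    obtain hm | hm := hm.lt_or_eq
    · rw [sum_add_distrib]
      exact add_pos_of_pos_of_nonneg hm (sum_nonneg fun _ _ => hslack p i)
    · refine sum_pos (fun a _ => add_pos_of_nonneg_of_pos (p.2.1 _) ?_) univ_nonempty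
      simp only [slack, ← hm, sub_zero]
      exact lt_max_of_lt_right (by positivity)
  let g (p : stdSimplex ℝ (Σ i, S i)) (i : ι) : stdSimplex ℝ (S i) :=
    normalize (fun a => p.1 ⟨i, a⟩ + slack p i) (fun a => add_nonneg (p.2.1 _) (hslack p i))
      (hpos p i)
  have hg : Continuous g := by
    refine continuous_pi fun i => continuous_normalize
      (q := fun (p : stdSimplex ℝ (Σ i, S i)) (a : S i) => p.1 ⟨i, a⟩ + slack p i)
      (fun a => (continuous_coord _).add ?_) _ _
    exact continuous_const.max
      (continuous_const.sub (continuous_finsetSum _ fun b _ => continuous_coord _))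
  have hsum : ∀ σ : ∀ i, stdSimplex ℝ (S i), ∑ x : Σ i, S i, (σ x.1).1 x.2 = Fintype.card ι := by
    intro σ
    rw [Fintype.sum_sigma, sum_congr rfl fun i _ => (σ i).2.2]
    simp
  let e (σ : ∀ i, stdSimplex ℝ (S i)) : stdSimplex ℝ (Σ i, S i) :=
    normalize (fun x => (σ x.1).1 x.2) (fun x => (σ x.1).2.1 _) (by rw [hsum]; exact hn)
  have he : Continuous e :=
    continuous_normalize (q := fun (σ : ∀ i, stdSimplex ℝ (S i)) (x : Σ i, S i) => (σ x.1).1 x.2)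
      (fun x => continuous_pi_coord _ _) _ _
  have hge : ∀ σ, g (e σ) = σ := by
    intro σ
    have hcoord : ∀ i a, (e σ).1 ⟨i, a⟩ = (σ i).1 a / Fintype.card ι := by
      intro i a
      rw [← hsum σ]
      rfl
    have hs : ∀ i, ∑ a, (e σ).1 ⟨i, a⟩ = 1 / Fintype.card ι := by
      intro i
      rw [sum_congr rfl fun a _ => hcoord i a, ← sum_div, (σ i).2.2]
    have hz : ∀ i, slack (e σ) i = 0 := by
      intro i
      simp only [slack, hs, sub_self, max_self]
    funext i
    refine Subtype.ext (funext fun a => ?_)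
    change ((e σ).1 ⟨i, a⟩ + slack (e σ) i) / ∑ a, ((e σ).1 ⟨i, a⟩ + slack (e σ) i) = _
    simp only [hz, add_zero]
    rw [hs, hcoord]
    field_simp
  have : Nonempty (Σ i, S i) := by
    obtain ⟨i⟩ := ‹Nonempty ι›
    exact (‹∀ i, Nonempty (S i)› i).map (Sigma.mk i)
  obtain ⟨p, hp⟩ := exists_fixedPoint (he.comp (hh.comp hg))
  refine ⟨g p, ?_⟩
  -- From `p = e (h (g p))` and `g ∘ e = id` follows `g p = h (g p)`.
  conv_rhs => rw [← hp]
  exact (hge _).symm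

end stdSimplex

/-! ### Nash's theorem -/

namespace FiniteGame

variable {ι : Type*} [Fintype ι] {S : ι → Type*} [∀ i, Fintype (S i)]

/-- The expectation of `u` when the players randomize independently according to `σ`. -/
noncomputable def expectation [DecidableEq ι] (u : (∀ i, S i) → ℝ)
    (σ : ∀ i, stdSimplex ℝ (S i)) : ℝ :=
  ∑ s, (∏ j, (σ j).1 (s j)) * u s

open Classical in
/-- The expectation of `u` when player `i` plays `a` and the others randomize according to `σ`. -/
noncomputable def expectationAgainst [DecidableEq ι] (u : (∀ i, S i) → ℝ) (i : ι)
    (a : S i) (σ : ∀ i, stdSimplex ℝ (S i)) : ℝ :=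
  ∑ s : ∀ i, S i, if s i = a then (∏ j ∈ univ.erase i, (σ j).1 (s j)) * u s else 0

theorem continuous_expectationAgainst [DecidableEq ι] (u : (∀ i, S i) → ℝ) (i : ι) (a : S i) :
    Continuous (expectationAgainst u i a) := by
  classical
  refine continuous_finsetSum _ fun s _ => ?_
  split_ifs
  · exact (continuous_finsetProd _ fun j _ => stdSimplex.continuous_pi_coord _ _).mul
      continuous_const
  · exact continuous_const

/-- `expectationAgainst` does not involve `σ i`, so the expectation is linear in the weights of
player `i`. -/
theorem expectation_update [DecidableEq ι] (u : (∀ i, S i) → ℝ) (σ : ∀ i, stdSimplex ℝ (S i))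
    (i : ι) (τ : stdSimplex ℝ (S i)) :
    expectation u (update σ i τ) = ∑ a, τ.1 a * expectationAgainst u i a σ := by
  classical
  simp only [expectation, expectationAgainst, mul_sum]
  rw [sum_comm]
  refine sum_congr rfl fun s _ => ?_
  simp only [mul_ite, mul_zero, sum_ite_eq, mem_univ, if_true]
  rw [← mul_prod_erase _ _ (mem_univ i), update_self, mul_assoc]
  congr 2
  refine prod_congr rfl fun j hj => ?_
  rw [update_of_ne (ne_of_mem_erase hj)]

theorem expectation_eq_sum [DecidableEq ι] (u : (∀ i, S i) → ℝ) (σ : ∀ i, stdSimplex ℝ (S i))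
    (i : ι) : expectation u σ = ∑ a, (σ i).1 a * expectationAgainst u i a σ := by
  rw [← expectation_update, update_eq_self]

/-- **Nash's theorem**: every finite game has an equilibrium in mixed strategies. -/
theorem exists_nash_equilibrium [DecidableEq ι] [Nonempty ι] [∀ i, Nonempty (S i)]
    (u : ι → (∀ i, S i) → ℝ) : ∃ σ : ∀ i, stdSimplex ℝ (S i), ∀ i (τ : stdSimplex ℝ (S i)),
      expectation (u i) (update σ i τ) ≤ expectation (u i) σ := by
  let gain (σ : ∀ i, stdSimplex ℝ (S i)) (i : ι) (a : S i) : ℝ :=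
    max 0 (expectationAgainst (u i) i a σ - expectation (u i) σ)
  have hgain : ∀ σ i a, 0 ≤ gain σ i a := fun σ i a => le_max_left _ _
  have hgainc : ∀ i a, Continuous fun σ => gain σ i a := by
    intro i a
    have : Continuous fun σ => expectation (u i) σ :=
      continuous_finsetSum _ fun s _ => (continuous_finsetProd _ fun j _ =>
        stdSimplex.continuous_pi_coord _ _).mul continuous_const
    exact continuous_const.max ((continuous_expectationAgainst (u i) i a).sub this)
  have hsum : ∀ (σ : ∀ i, stdSimplex ℝ (S i)) i,
      ∑ a, ((σ i).1 a + gain σ i a) = 1 + ∑ a, gain σ i a := by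
    intro σ i
    rw [sum_add_distrib, (σ i).2.2]
  have hpos : ∀ (σ : ∀ i, stdSimplex ℝ (S i)) i, 0 < ∑ a, ((σ i).1 a + gain σ i a) := by
    intro σ i
    rw [hsum]
    exact add_pos_of_pos_of_nonneg one_pos (sum_nonneg fun a _ => hgain σ i a)
  let h (σ : ∀ i, stdSimplex ℝ (S i)) (i : ι) : stdSimplex ℝ (S i) :=
    stdSimplex.normalize (fun a => (σ i).1 a + gain σ i a)
      (fun a => add_nonneg ((σ i).2.1 a) (hgain σ i a)) (hpos σ i)
  have hh : Continuous h := continuous_pi fun i => stdSimplex.continuous_normalize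
    (q := fun (σ : ∀ i, stdSimplex ℝ (S i)) (a : S i) => (σ i).1 a + gain σ i a)
    (fun a => (stdSimplex.continuous_pi_coord i a).add (hgainc i a)) _ _
  obtain ⟨σ, hσ⟩ := stdSimplex.exists_fixedPoint_pi hh
  refine ⟨σ, fun i τ => ?_⟩
  have hfix : ∀ a, (σ i).1 a * ∑ b, gain σ i b = gain σ i a := by
    intro a
    have h1 : ((σ i).1 a + gain σ i a) / ∑ b, ((σ i).1 b + gain σ i b) = (σ i).1 a :=
      congrFun (congrArg Subtype.val (congrFun hσ i)) a
    rw [div_eq_iff (hpos σ i).ne', hsum] at h1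
    linarith
  -- The expectation is a weighted average, so not every played strategy beats it. One that does not
  -- has zero gain, and `hfix` then kills the total gain.
  obtain ⟨a, ha, hle⟩ : ∃ a, 0 < (σ i).1 a ∧
      expectationAgainst (u i) i a σ ≤ expectation (u i) σ := by
    by_contra! hlt
    obtain ⟨a, -, ha⟩ : ∃ a ∈ univ, 0 < (σ i).1 a :=
      exists_lt_of_sum_lt (by simp [(σ i).2.2])
    have h1 : ∑ a, (σ i).1 a * expectation (u i) σ <
        ∑ a, (σ i).1 a * expectationAgainst (u i) i a σ := by
      refine sum_lt_sum (fun b _ => ?_) ⟨a, mem_univ a, mul_lt_mul_of_pos_left (hlt a ha) ha⟩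
      obtain hb | hb := ((σ i).2.1 b).lt_or_eq
      · exact (mul_lt_mul_of_pos_left (hlt b hb) hb).le
      · rw [← hb, zero_mul, zero_mul]
    rw [← expectation_eq_sum, ← sum_mul, (σ i).2.2, one_mul] at h1
    exact lt_irrefl _ h1
  have hzero : ∑ b, gain σ i b = 0 := by
    have h1 := hfix a
    have h2 : gain σ i a = 0 := max_eq_left (sub_nonpos.2 hle)
    rw [h2] at h1
    exact (mul_eq_zero.1 h1).resolve_left ha.ne'
  have hbest : ∀ b, expectationAgainst (u i) i b σ ≤ expectation (u i) σ := by
    intro b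
    have h1 : gain σ i b = 0 := by rw [← hfix b, hzero, mul_zero]
    have h2 := le_max_right 0 (expectationAgainst (u i) i b σ - expectation (u i) σ)
    change _ ≤ gain σ i b at h2
    linarith
  calc expectation (u i) (update σ i τ) = ∑ b, τ.1 b * expectationAgainst (u i) i b σ :=
        expectation_update _ _ _ _
    _ ≤ ∑ b, τ.1 b * expectation (u i) σ :=
        sum_le_sum fun b _ => mul_le_mul_of_nonneg_left (hbest b) (τ.2.1 b)
    _ = expectation (u i) σ := by rw [← sum_mul, τ.2.2, one_mul]

end FiniteGame

/-! ### Equilibria of coalition games -/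

namespace CoalitionGame

variable {ι : Type*} [Fintype ι] [DecidableEq ι] {A : ι → Type*} {K : ℕ}

/-- The fibres of the mechanism partition the strategy profiles. -/
theorem expectedUtility_eq_expectation (G : CoalitionGame ι A K) (i : ι) (σ : G.MixedProfile) :
    G.expectedUtility i σ =
      FiniteGame.expectation (fun s => G.payoff i (G.mech s) ⟨s, rfl⟩) σ := by
  classical
  unfold expectedUtility FiniteGame.expectation
  rw [← Fintype.sum_sigma',
    ← (Equiv.sigmaFiberEquiv G.mech).sum_comp]
  refine Fintype.sum_congr _ _ ?_
  rintro ⟨_, s, rfl⟩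
  rfl

theorem exists_isEquilibrium [Nonempty ι] (G : CoalitionGame ι A K) :
    ∃ σ : G.MixedProfile, G.IsEquilibrium σ := by
  have : ∀ i, Nonempty ↥(strategySet G.strat i) := fun i => (G.strat_nonempty i).to_subtype
  obtain ⟨σ, hσ⟩ := FiniteGame.exists_nash_equilibrium
    fun i (s : G.Profile) => G.payoff i (G.mech s) ⟨s, rfl⟩
  refine ⟨σ, fun n _ _ i _ τ _ => ?_⟩
  rw [expectedUtility_eq_expectation, expectedUtility_eq_expectation]
  exact hσ i τ

end CoalitionGame

theorem theorem2 {ι : Type*} [Fintype ι] [DecidableEq ι] (hN : 2 ≤ Fintype.card ι)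
    {A : ι → Type*} (𝒢 : NestedGameFamily ι A) :
    ∃ σ : ∀ K : Set.Icc 1 (Fintype.card ι), (𝒢.game K).MixedProfile,
      ∀ K : Set.Icc 1 (Fintype.card ι), (𝒢.game K).IsEquilibrium (σ K) := by
  have : Nonempty ι := Fintype.card_pos_iff.1 (by omega)
  choose σ hσ using fun K => (𝒢.game K).exists_isEquilibrium
  exact ⟨σ, hσ⟩
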